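/- **Setting.** Let $\mathbb N^*=\{0,0^*,1,1^*,\dots\}$ be ordered by $0\prec 0^*\prec 1\prec 1^*\prec\cdots$, where $*$ denotes holding (for a budget) or using (for a bid) the tie-breaking advantage; "successor" refers to this order. For $x,y\in\mathbb N$ put $x\oplus y=x+y$, $x^*\oplus y=x\oplus y^*=(x+y)^*$, $x^*\oplus y^*=x+y+1$, and $x\ominus y=x^*\ominus y^*=x-y$, $x^*\ominus y=(x-y)^*$, $x\ominus y^*=(x-y-1)^*$. An energy bidding game $\mathcal G=\langle V,E,k,w\rangle$ consists of a finite directed graph in which every vertex $v$ has a nonempty set $N(v)$ of neighbors, a total budget $k\in\mathbb N$, and integer edge weights; $W$ is the largest absolute value of a weight. Let $[k]=\{0,0^*,\dots,k,k^*\}$. In a configuration $\langle v,B\rangle$, $v\in V$, $B\in[k]$, the token is on $v$, Preserver has budget $B$ and Consumer has budget $k^*\ominus B$. In each turn both players simultaneously choose a bid within their budget (a bid $b^*$ is possible only for the player who holds the advantage) and a neighbor of $v$. The higher bid wins; if the bids are equal, the player who holds the advantage has not used it and the other player wins. The winner pays the bid to the other player and moves the token to the chosen neighbor: Preserver's budget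 becomes $B\ominus b$ if she wins with $b$, and $B\oplus b$ if Consumer wins with $b$. Strategies are deterministic and may depend on the history. A Preserver strategy $M$-wins from $\langle v,B\rangle$ if against every Consumer strategy, $M$ plus the sum of the weights of every finite prefix of the resulting path is nonnegative. **Thresholds.** $\mathrm{energy}(v,B)\in\mathbb N\cup\{\infty\}$ is the least $M$ such that Preserver has an $M$-winning strategy from $\langle v,B\rangle$, and $\infty$ if there is none. $\mathrm{Th}(v)$ is the least $B\in[k]$ with $\mathrm{energy}(v,B)<\infty$, and $k+1$ if there is none. **Value iteration.** For a Preserver bid $b$ at budget $B$ let $\mathrm{trump}(B,b)$ be $b$ if Preserver holds the advantage and does not use it in $b$, and the successor of $b$ otherwise. For $\mu:V\times[k]\to\mathbb N\cup\{\infty\}$ let $$\mathrm{ewin}_\mu(v,B,b)=\min_{u\in N(v)}\max\{\mu(u,B\ominus b)-w(v,u),0\},$$ $$\mathrm{elose}_\mu(v,B,b)=\max_{u\in N(v)}\max\{\mu(u,B\oplus\mathrm{trump}(B,b))-w(v,u),0\},$$ and let $\mathrm{enext}_\mu(v,B,b)=\max\{\mathrm{ewin}_\mu(v,B,b),\mathrm{elose}_\mu(v,B,b)\}$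 if $B\oplus\mathrm{trump}(B,b)\preceq k^*$, and $\mathrm{ewin}_\mu(v,B,b)$ otherwise. Put $\mu_0=0$ and $\mu_{n+1}(v,B)=\min_b\mathrm{enext}_{\mu_n}(v,B,b)$ over the possible bids $b$. Replace every value of $\mu_n$ greater than $|V|\,(2k+2)\,W$ by $\infty$ (note that $|V|(2k+2)$ is the number of configurations); let $\mu$ be the function at which the resulting increasing sequence stabilizes. A *value-iteration strategy* is a map $\sigma_{\mathrm{VI}}$ that assigns to each $\langle v,B\rangle$ a pair $\langle b',u'\rangle$ such that $b'$ is a possible bid that minimizes $\mathrm{enext}_\mu(v,B,\cdot)$ and $u'\in N(v)$ minimizes $\max\{\mu(u,B\ominus b')-w(v,u),0\}$; ties are resolved arbitrarily. **The budget-agnostic strategy.** For $B\succeq\mathrm{Th}(v)$ let $\mathrm{rel}(v,B)$ be whichever of $\mathrm{Th}(v)$ and its successor agrees with $B$ on holding the advantage. Define $\sigma_{\mathrm{agn}}(v,B)=\sigma_{\mathrm{VI}}(v,\mathrm{rel}(v,B))$ if $B\succeq\mathrm{Th}(v)$, and (to obtain a strategy that is defined everywhere) $\sigma_{\mathrm{agn}}(v,B)=\sigma_{\mathrm{VI}}(v,B)$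 otherwise. **Theorem.** Value-iteration strategies exist, and for every value-iteration strategy $\sigma_{\mathrm{VI}}$ the following holds. The strategy $\sigma_{\mathrm{agn}}$ is budget-agnostic: after every history that ends in $\langle v,B\rangle$ with $B\succeq\mathrm{Th}(v)$, it chooses the same bid as after every history that ends in $\langle v,\mathrm{rel}(v,B)\rangle$. Moreover, for every configuration $\langle v,B\rangle$ with $B\in[k]$ and $B\succeq\mathrm{Th}(v)$, $$M=(k+1)\cdot\Bigl(W+\max_{u\in V,\ \mathrm{Th}(u)\in[k]}\mathrm{energy}(u,\mathrm{Th}(u))\Bigr)$$ is finite, and $\sigma_{\mathrm{agn}}$ uses only allowed actions and $M$-wins from $\langle v,B\rangle$. -/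

import Mathlib

noncomputable section

namespace EnergyBidding

open Classical

/-! ## Budgets with a tie-breaking advantage

An element of `ℕ* = {0, 0*, 1, 1*, …}` is represented by its position in the order
`0 ≺ 0* ≺ 1 ≺ 1* ≺ …`: the integer budget `x` is `2 * x` and `x*` is `2 * x + 1`.
Then `≺` is `<`, the successor is `+ 1`, the integral part is `/ 2`, "holds the advantage" is
`Odd`, and (see the four facts on each operator below) `⊕` and `⊖` are `+` and `-`. -/

/-- The budget or bid `x` without the advantage. -/
def plain (x : ℕ) : ℕ := 2 * x

/-- The budget or bid `x*`, that is, `x` with the advantage. -/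
def star (x : ℕ) : ℕ := 2 * x + 1

theorem plain_add_plain (x y : ℕ) : plain x + plain y = plain (x + y) := by
  unfold plain; omega

theorem star_add_plain (x y : ℕ) : star x + plain y = star (x + y) := by
  unfold plain star; omega

theorem plain_add_star (x y : ℕ) : plain x + star y = star (x + y) := by
  unfold plain star; omega

theorem star_add_star (x y : ℕ) : star x + star y = plain (x + y + 1) := by
  unfold plain star; omega

theorem plain_sub_plain (x y : ℕ) : plain x - plain y = plain (x - y) := by
  unfold plain; omega

theorem star_sub_plain (x y : ℕ) (h : y ≤ x) : star x - plain y = star (x - y) := by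
  unfold plain star; omega

theorem star_sub_star (x y : ℕ) : star x - star y = plain (x - y) := by
  unfold plain star; omega

theorem plain_sub_star (x y : ℕ) (h : y + 1 ≤ x) : plain x - star y = star (x - y - 1) := by
  unfold plain star; omega

/-! ## The game -/

/-- The arena of an energy bidding game: a directed graph in which every vertex has a neighbor,
integer weights on the edges (only the values of `weight` on edges matter), and a total
budget `k`. -/
structure Game (V : Type*) where
  Adj : V → V → Prop
  exists_adj : ∀ v, ∃ u, Adj v u
  weight : V → V → ℤ
  k : ℕ

/-- A configuration `⟨v, B⟩`: the token is on `v`, Preserver has budget `B`. -/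
abbrev Config (V : Type*) := V × ℕ

/-- An action `⟨b, u⟩`: bid `b`, and move to `u` upon winning the bidding. -/
abbrev Action (V : Type*) := ℕ × V

/-- A strategy maps the past configurations and the current one to an action. -/
abbrev Strategy (V : Type*) := List (Config V) → Config V → Action V

/-- `b` is a possible bid for a player with budget `B`: it is within the budget, and it uses the
advantage only if the player holds it. -/
def IsBid (B b : ℕ) : Prop := b ≤ B ∧ (Odd b → Odd B)

namespace Game

variable {V : Type*} (G : Game V)

/-- The budget `k*`; the set `[k] = {0, 0*, …, k, k*}` is `{B | B ≤ G.kstar}`, the formal value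
`k + 1` is `G.kstar + 1`, and the opponent of a player with budget `B` has `G.kstar - B`. -/
def kstar : ℕ := star G.k

/-- Preserver's strategy `σ` chooses only allowed actions. -/
def PresLegal (σ : Strategy V) : Prop :=
  ∀ (h : List (Config V)) (v : V) (B : ℕ), B ≤ G.kstar →
    IsBid B (σ h (v, B)).1 ∧ G.Adj v (σ h (v, B)).2

/-- Consumer's strategy `τ` chooses only allowed actions. -/
def ConsLegal (τ : Strategy V) : Prop :=
  ∀ (h : List (Config V)) (v : V) (B : ℕ), B ≤ G.kstar →
    IsBid (G.kstar - B) (τ h (v, B)).1 ∧ G.Adj v (τ h (v, B)).2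

end Game

variable {V : Type*}

/-- Preserver wins the bidding at budget `B` with bid `b₁` against `b₂`. The higher bid wins. In a
tie the player who holds the advantage did not use it, and the other player wins. -/
def PresWinsBidding (B b₁ b₂ : ℕ) : Prop := b₂ < b₁ ∨ (b₁ = b₂ ∧ ¬ Odd B)

/-- The next configuration when Preserver and Consumer choose `a₁` and `a₂`: the winner of the
bidding pays the bid to the other player and moves the token. -/
def step (c : Config V) (a₁ a₂ : Action V) : Config V :=
  if PresWinsBidding c.2 a₁.1 a₂.1 then (a₁.2, c.2 - a₁.1) else (a₂.2, c.2 + a₂.1)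

/-- Past and current configuration after `n` turns of the play of `σ` against `τ` from `c`. -/
def run (c : Config V) (σ τ : Strategy V) : ℕ → List (Config V) × Config V
  | 0 => ([], c)
  | n + 1 =>
    let p := run c σ τ n
    (p.1 ++ [p.2], step p.2 (σ p.1 p.2) (τ p.1 p.2))

/-- The path of vertices that the token follows. -/
def path (c : Config V) (σ τ : Strategy V) (n : ℕ) : V := (run c σ τ n).2.1

namespace Game

variable (G : Game V)

/-- The energy (sum of weights) of the prefix of length `m` of an infinite path. -/
def sumWeights (π : ℕ → V) (m : ℕ) : ℤ := ∑ j ∈ Finset.range m, G.weight (π j) (π (j + 1))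

/-- Preserver `M`-wins the infinite path `π`. -/
def PresWinsPath (M : ℕ) (π : ℕ → V) : Prop := ∀ m : ℕ, 0 ≤ (M : ℤ) + G.sumWeights π m

/-- Preserver's strategy `σ` is allowed and `M`-wins from `c`. -/
def StrategyWins (σ : Strategy V) (M : ℕ) (c : Config V) : Prop :=
  G.PresLegal σ ∧ ∀ τ : Strategy V, G.ConsLegal τ → G.PresWinsPath M (path c σ τ)

/-- The energy threshold: the least initial energy with which Preserver wins from `⟨v, B⟩`, and `∞`
if there is none. -/
def energy (v : V) (B : ℕ) : ℕ∞ :=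
  ⨅ (M : ℕ) (_ : ∃ σ : Strategy V, G.StrategyWins σ M (v, B)), (M : ℕ∞)

/-- The threshold budget: the least `B ∈ [k]` for which the energy threshold is finite, and `k + 1`
if there is none. -/
def Th (v : V) : ℕ :=
  if ∀ B ≤ G.kstar, G.energy v B = ⊤ then G.kstar + 1
  else sInf {B | B ≤ G.kstar ∧ G.energy v B < ⊤}

/-! ## The budget-agnostic strategy -/

/-- Trimming of excess budget: whichever of `Th(v)` and its successor agrees with `B` on the
advantage. -/
def relBud (v : V) (B : ℕ) : ℕ := if (Odd B ↔ Odd (G.Th v)) then G.Th v else G.Th v + 1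

/-- The strategy that plays `s` as if the budget were `relBud v B`, whenever `B ≥ Th(v)`. For other
budgets it is completed to a strategy by `s` itself. -/
def agnostic (s : Config V → Action V) : Strategy V :=
  fun _ c => if G.Th c.1 ≤ c.2 then s (c.1, G.relBud c.1 c.2) else s c

/-- The bid of `σ` depends only on the vertex and on the trimmed budget: at `⟨v, B⟩` with
`B ≥ Th(v)` it is the bid at `⟨v, relBud v B⟩`, whatever the histories. -/
def BudgetAgnostic (σ : Strategy V) : Prop :=
  ∀ (v : V) (B : ℕ), B ≤ G.kstar → G.Th v ≤ B →
    ∀ h₁ h₂ : List (Config V), (σ h₁ (v, B)).1 = (σ h₂ (v, G.relBud v B)).1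

/-! ## Value iteration -/

/-- The least bid with which Consumer wins against Preserver's bid `b` at budget `B`. -/
def trump (B b : ℕ) : ℕ := if Odd B ∧ ¬ Odd b then b else b + 1

/-- `max {e - w, 0}`: the energy required before traversing an edge of weight `w` in order to have
`e` afterwards. -/
def required (e : ℕ∞) (w : ℤ) : ℕ∞ := ENat.map (fun n : ℕ => ((n : ℤ) - w).toNat) e

/-- The energy that Preserver requires at `⟨v, B⟩` if she wins the bidding with `b`, where `μ` is
required afterwards. -/
def eWin (μ : V → ℕ → ℕ∞) (v : V) (B b : ℕ) : ℕ∞ :=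
  ⨅ (u : V) (_ : G.Adj v u), required (μ u (B - b)) (G.weight v u)

/-- The energy that Preserver requires at `⟨v, B⟩` if she bids `b` and Consumer trumps it. -/
def eLose (μ : V → ℕ → ℕ∞) (v : V) (B b : ℕ) : ℕ∞ :=
  ⨆ (u : V) (_ : G.Adj v u), required (μ u (B + trump B b)) (G.weight v u)

/-- The energy that Preserver requires at `⟨v, B⟩` if she bids `b`. -/
def eNext (μ : V → ℕ → ℕ∞) (v : V) (B b : ℕ) : ℕ∞ :=
  if B + trump B b ≤ G.kstar then max (G.eWin μ v B b) (G.eLose μ v B b) else G.eWin μ v B b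

/-- The iterates `μ₀ = 0`, `μₙ₊₁(v, B) = min_b eNext(v, B, b)` over the possible bids `b`. -/
def muIter : ℕ → V → ℕ → ℕ∞
  | 0 => fun _ _ => 0
  | n + 1 => fun v B => ⨅ (b : ℕ) (_ : IsBid B b), G.eNext (muIter n) v B b

/-- `W`, the largest absolute value of the weight of an edge. -/
def maxWeight [Fintype V] : ℕ :=
  (Finset.univ.filter (fun e : V × V => G.Adj e.1 e.2)).sup
    (fun e => (G.weight e.1 e.2).natAbs)

/-- The trimmed iterates: values above `N * W` are replaced by `∞`, where `N = |V| * (2 * k + 2)` is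
the number of pairs in `V × [k]`. -/
def muTrim [Fintype V] (n : ℕ) (v : V) (B : ℕ) : ℕ∞ :=
  if G.muIter n v B ≤ ((Fintype.card V * (2 * G.k + 2) * G.maxWeight : ℕ) : ℕ∞)
  then G.muIter n v B else ⊤

/-- The function at which the (increasing) sequence of trimmed iterates stabilizes. -/
def mu [Fintype V] (v : V) (B : ℕ) : ℕ∞ := ⨆ n : ℕ, G.muTrim n v B

/-- `s` is a strategy that value iteration gives rise to: at `⟨v, B⟩` it bids some `b'` that
minimizes the required energy `eNext`, and upon winning moves to some neighbor that attains the
minimum in `eWin` for `b'`. Ties between minimizers may be resolved in any way. -/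
def IsVIStrategy [Fintype V] (s : Config V → Action V) : Prop :=
  ∀ (v : V) (B : ℕ), B ≤ G.kstar →
    (IsBid B (s (v, B)).1 ∧
      ∀ b, IsBid B b → G.eNext G.mu v B (s (v, B)).1 ≤ G.eNext G.mu v B b) ∧
    (G.Adj v (s (v, B)).2 ∧
      ∀ u, G.Adj v u →
        required (G.mu (s (v, B)).2 (B - (s (v, B)).1)) (G.weight v (s (v, B)).2) ≤
          required (G.mu u (B - (s (v, B)).1)) (G.weight v u))

/-- `(k + 1) * (W + max_v energy(v, Th(v)))`, where `v` ranges over the vertices with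
`Th(v) ∈ [k]` (for the others there is no budget `Th(v)` and no finite energy). -/
def initialEnergy [Fintype V] : ℕ∞ :=
  ((G.k + 1 : ℕ) : ℕ∞) *
    ((G.maxWeight : ℕ∞) + ⨆ (v : V) (_ : G.Th v ≤ G.kstar), G.energy v (G.Th v))

end Game

end EnergyBidding

end

namespace EnergyBidding

open Classical

variable {V : Type*}

namespace Game

/-! ## Required energies -/

/-! The limit of value iteration is the least solution of the optimality inequality
(`isPrefixed_muLim`, `muLim_le_of_isPrefixed`), and trimming does not alter it: among finite values
there is no gap of length `W`, so they stay below the number of configurations times `W`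
(`exists_muLim_mem_Ioc`, `muLim_le_of_ne_top`). This limit is the energy threshold (`energy_eq_mu`):
thresholds satisfy the optimality inequality, and a value-iteration strategy keeps the energy above
`mu`.

For the budget-agnostic strategy, call `B - relBud v B` the excess; it is even. Playing as if the
excess were absent preserves it and keeps the energy above `mu` at the simulated budget
(`IsVIStrategy.step_eq`). If the simulated budget then has to be trimmed further, `mu` may jump, but
only to at most `E`, the largest energy at a threshold, while the excess grows by at least 2. The
excess is at most `2k`, so at most `k` such jumps occur; a reserve of `E` for each, plus `E` at the
start, gives `(k + 1) * E` (`IsVIStrategy.strategyWins_agnostic`). -/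

theorem map_natCast_eq (f : ℕ → ℕ) (n : ℕ) : ENat.map f (n : ℕ∞) = ((f n : ℕ) : ℕ∞) := rfl

theorem required_natCast (n : ℕ) (w : ℤ) : required n w = (((n : ℤ) - w).toNat : ℕ) := rfl

theorem required_top (w : ℤ) : required ⊤ w = ⊤ := rfl

theorem required_le_coe_iff (x : ℕ∞) (w : ℤ) (m : ℕ) :
    required x w ≤ m ↔ ∃ n : ℕ, x = n ∧ (n : ℤ) ≤ m + w := by
  induction x using ENat.recTopCoe with
  | top => simp [required_top]
  | coe n =>
    simp only [required_natCast, Nat.cast_le, Nat.cast_inj, exists_eq_left']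
    omega

theorem required_mono {x y : ℕ∞} (h : x ≤ y) (w : ℤ) : required x w ≤ required y w := by
  induction y using ENat.recTopCoe with
  | top => simp [required_top]
  | coe n =>
    obtain ⟨m, rfl⟩ := ENat.ne_top_iff_exists.1 (ne_top_of_le_ne_top (ENat.natCast_ne_top n) h)
    simp only [required_natCast, Nat.cast_le] at h ⊢
    omega

theorem required_iSup_le {f : ℕ → ℕ∞} {w : ℤ} {x : ℕ∞} (h : ∀ n, required (f n) w ≤ x) :
    required (⨆ n, f n) w ≤ x := by
  induction x using ENat.recTopCoe with
  | top => exact le_top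
  | coe m =>
    simp only [required_le_coe_iff] at h
    -- Any index shows `0 ≤ m + w`, so that `toNat` below truncates nothing.
    obtain ⟨n₀, -, h₀⟩ := h 0
    have hle : (⨆ n, f n) ≤ (((m : ℤ) + w).toNat : ℕ∞) := by
      refine iSup_le fun n => ?_
      obtain ⟨i, hi, hi'⟩ := h n
      rw [hi, Nat.cast_le]
      omega
    obtain ⟨i, hi⟩ := ENat.ne_top_iff_exists.1 (ne_top_of_le_ne_top (ENat.natCast_ne_top _) hle)
    rw [required_le_coe_iff]
    refine ⟨i, hi.symm, ?_⟩
    rw [← hi, Nat.cast_le] at hle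
    omega

theorem biInf_le_iff {α : Type*} {p : α → Prop} (hp : ∃ a, p a) (f : α → ℕ∞) (x : ℕ∞) :
    (⨅ (a : α) (_ : p a), f a) ≤ x ↔ ∃ a, p a ∧ f a ≤ x := by
  rw [iInf_subtype']
  have : Nonempty {a // p a} := let ⟨a, ha⟩ := hp; ⟨⟨a, ha⟩⟩
  constructor
  · intro h
    obtain ⟨⟨a, ha⟩, hfa⟩ := ciInf_mem fun a : {a // p a} => f a
    exact ⟨a, ha, hfa.le.trans h⟩
  · rintro ⟨a, ha, hfa⟩
    exact (iInf_le _ (⟨a, ha⟩ : {a // p a})).trans hfa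

/-- A compactness principle: if each of the finitely many `a` failed at some index, all would fail
at the largest of these. -/
theorem exists_forall_of_antitone {α : Type*} [Finite α] {P : ℕ → α → Prop}
    (hP : ∀ a m n, m ≤ n → P n a → P m a) (h : ∀ n, ∃ a, P n a) : ∃ a, ∀ n, P n a := by
  cases nonempty_fintype α
  by_contra! hc
  choose N hN using hc
  obtain ⟨a, ha⟩ := h (Finset.univ.sup N)
  exact hN a (hP a _ _ (Finset.le_sup (Finset.mem_univ a)) ha)

theorem isBid_zero (B : ℕ) : IsBid B 0 := ⟨Nat.zero_le _, by simp⟩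

/-! ### The value-iteration operator and its least prefixed point -/

variable (G : Game V)

theorem kstar_eq : G.kstar = 2 * G.k + 1 := rfl

theorem eNext_le_iff (μ : V → ℕ → ℕ∞) (v : V) (B b : ℕ) (x : ℕ∞) :
    G.eNext μ v B b ≤ x ↔
      (∃ u, G.Adj v u ∧ required (μ u (B - b)) (G.weight v u) ≤ x) ∧
      (B + trump B b ≤ G.kstar →
        ∀ u, G.Adj v u → required (μ u (B + trump B b)) (G.weight v u) ≤ x) := by
  unfold eNext
  split_ifs with h
  · simp only [max_le_iff, eWin, eLose, biInf_le_iff (G.exists_adj v), iSup_le_iff, h,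
      true_imp_iff]
  · simp only [eWin, biInf_le_iff (G.exists_adj v), h, false_imp_iff, and_true]

theorem eNext_le_eNext {μ ν : V → ℕ → ℕ∞} {v : V} {B b : ℕ} {x y : ℕ∞} (hB : B ≤ G.kstar)
    (h : ∀ u R, G.Adj v u → R ≤ G.kstar → required (μ u R) (G.weight v u) ≤ x →
      required (ν u R) (G.weight v u) ≤ y)
    (hx : G.eNext μ v B b ≤ x) : G.eNext ν v B b ≤ y := by
  rw [eNext_le_iff] at hx ⊢
  obtain ⟨⟨u, hu, hu'⟩, hl⟩ := hx
  exact ⟨⟨u, hu, h u _ hu (by omega) hu'⟩, fun hk u hu => h u _ hu hk (hl hk u hu)⟩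

theorem eNext_mono {μ ν : V → ℕ → ℕ∞} (h : ∀ v B, B ≤ G.kstar → μ v B ≤ ν v B) {v : V} {B : ℕ}
    (hB : B ≤ G.kstar) (b : ℕ) : G.eNext μ v B b ≤ G.eNext ν v B b :=
  G.eNext_le_eNext hB (fun u R _ hR hx => (required_mono (h u R hR) _).trans hx) le_rfl

theorem muIter_succ_le_iff (n : ℕ) (v : V) (B : ℕ) (x : ℕ∞) :
    G.muIter (n + 1) v B ≤ x ↔ ∃ b, IsBid B b ∧ G.eNext (G.muIter n) v B b ≤ x :=
  biInf_le_iff ⟨0, isBid_zero B⟩ _ _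

/-- The functions that satisfy the optimality inequality of value iteration on `[k]`. -/
def IsPrefixed (μ : V → ℕ → ℕ∞) : Prop :=
  ∀ v B, B ≤ G.kstar → ∃ b, IsBid B b ∧ G.eNext μ v B b ≤ μ v B

theorem muIter_le_of_isPrefixed {μ : V → ℕ → ℕ∞} (hμ : G.IsPrefixed μ) (n : ℕ) :
    ∀ v B, B ≤ G.kstar → G.muIter n v B ≤ μ v B := by
  induction n with
  | zero => intro v B _; exact bot_le
  | succ n ih =>
    intro v B hB
    obtain ⟨b, hb, hb'⟩ := hμ v B hB
    exact (G.muIter_succ_le_iff n v B _).2 ⟨b, hb, (G.eNext_mono ih hB b).trans hb'⟩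

theorem muIter_le_succ (n : ℕ) : ∀ v B, B ≤ G.kstar → G.muIter n v B ≤ G.muIter (n + 1) v B := by
  induction n with
  | zero => intro v B _; exact bot_le
  | succ n ih =>
    intro v B hB
    obtain ⟨b, hb, hb'⟩ := (G.muIter_succ_le_iff (n + 1) v B _).1 le_rfl
    exact (G.muIter_succ_le_iff n v B _).2 ⟨b, hb, (G.eNext_mono ih hB b).trans hb'⟩

theorem muIter_mono {m n : ℕ} (h : m ≤ n) {v : V} {B : ℕ} (hB : B ≤ G.kstar) :
    G.muIter m v B ≤ G.muIter n v B :=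
  monotone_nat_of_le_succ (f := fun n => G.muIter n v B) (fun n => G.muIter_le_succ n v B hB) h

/-- A bid that uses the advantage is unavailable at `B + 1`, which lacks it, and is rounded up; any
other bid is kept. Hence more budget never hurts. -/
theorem exists_bid_succ {B b : ℕ} (hb : IsBid B b) :
    ∃ c, IsBid (B + 1) c ∧ B - b ≤ B + 1 - c ∧ B + trump B b ≤ B + 1 + trump (B + 1) c := by
  obtain ⟨hb, hodd⟩ := hb
  refine ⟨if Odd b then b + 1 else b, ?_⟩
  simp only [IsBid, trump, Nat.odd_iff] at *
  split_ifs <;> omega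

theorem muIter_antitone (n : ℕ) : ∀ v, Antitone (G.muIter n v) := by
  induction n with
  | zero => intro v _ _ _; exact bot_le
  | succ n ih =>
    refine fun v => antitone_nat_of_succ_le fun B => ?_
    obtain ⟨b, hb, hb'⟩ := (G.muIter_succ_le_iff n v B _).1 le_rfl
    obtain ⟨c, hc, hwin, hlose⟩ := exists_bid_succ hb
    refine (G.muIter_succ_le_iff n v (B + 1) _).2 ⟨c, hc, ?_⟩
    rw [eNext_le_iff] at hb' ⊢
    obtain ⟨⟨u, hu, hu'⟩, hl⟩ := hb'
    exact ⟨⟨u, hu, (required_mono (ih u hwin) _).trans hu'⟩, fun hk u hu =>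
      (required_mono (ih u hlose) _).trans (hl (hlose.trans hk) u hu)⟩

/-- The limit of the iterates without trimming. -/
noncomputable def muLim (v : V) (B : ℕ) : ℕ∞ := ⨆ n, G.muIter n v B

theorem muLim_antitone (v : V) : Antitone (G.muLim v) :=
  fun _ _ h => iSup_mono fun n => G.muIter_antitone n v h

theorem muLim_le_of_isPrefixed {μ : V → ℕ → ℕ∞} (hμ : G.IsPrefixed μ) {v : V} {B : ℕ}
    (hB : B ≤ G.kstar) : G.muLim v B ≤ μ v B :=
  iSup_le fun n => G.muIter_le_of_isPrefixed hμ n v B hB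

/-- The optimal bid and neighbor may vary with the iterate, but there are finitely many pairs and
the conditions on them tighten with `n`, so one pair serves all iterates and hence their supremum.
-/
theorem isPrefixed_muLim [Fintype V] : G.IsPrefixed G.muLim := by
  intro v B hB
  obtain ⟨⟨b, u⟩, h⟩ := exists_forall_of_antitone (α := Fin (B + 1) × V)
    (P := fun n a => IsBid B a.1 ∧ G.Adj v a.2 ∧
      required (G.muIter n a.2 (B - a.1)) (G.weight v a.2) ≤ G.muLim v B ∧
      (B + trump B a.1 ≤ G.kstar → ∀ u, G.Adj v u →
        required (G.muIter n u (B + trump B a.1)) (G.weight v u) ≤ G.muLim v B))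
    (fun a m n hmn ha => ⟨ha.1, ha.2.1,
      (required_mono (G.muIter_mono hmn (by omega)) _).trans ha.2.2.1,
      fun hk u hu => (required_mono (G.muIter_mono hmn hk) _).trans (ha.2.2.2 hk u hu)⟩)
    (fun n => by
      obtain ⟨b, hb, hb'⟩ := (G.muIter_succ_le_iff n v B (G.muLim v B)).1
        (le_iSup (fun n => G.muIter n v B) (n + 1))
      obtain ⟨⟨u, hu, hu'⟩, hl⟩ := (G.eNext_le_iff _ _ _ _ _).1 hb'
      exact ⟨⟨⟨b, by have := hb.1; omega⟩, u⟩, hb, hu, hu', hl⟩)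
  refine ⟨b, (h 0).1, (G.eNext_le_iff _ _ _ _ _).2 ⟨⟨u, (h 0).2.1, ?_⟩, fun hk u hu => ?_⟩⟩
  · exact required_iSup_le fun n => (h n).2.2.1
  · exact required_iSup_le fun n => (h n).2.2.2 hk u hu

/-! ### Bounding the finite values, and trimming -/

theorem natAbs_weight_le [Fintype V] {v u : V} (h : G.Adj v u) :
    (G.weight v u).natAbs ≤ G.maxWeight :=
  Finset.le_sup (f := fun e : V × V => (G.weight e.1 e.2).natAbs) (b := (v, u)) (by simpa using h)

/-- The finite values of `muLim` leave no gap of length `W`. -/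
theorem exists_muLim_mem_Ioc [Fintype V] {v : V} {B m : ℕ} (hB : B ≤ G.kstar)
    (hm : G.muLim v B = m) {t : ℕ} (ht : t + G.maxWeight < m) :
    ∃ u R n, R ≤ G.kstar ∧ G.muLim u R = (n : ℕ) ∧ t < n ∧ n ≤ t + G.maxWeight := by
  by_contra! hgap
  -- Lowering every value above the gap by one preserves the optimality inequality: values above the
  -- gap exceed those below by more than `W`, more than one edge can consume. This contradicts
  -- leastness at `⟨v, B⟩`.
  let f : ℕ → ℕ := fun n => if t + G.maxWeight < n then n - 1 else n
  have hpre : G.IsPrefixed fun v B => ENat.map f (G.muLim v B) := by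
    intro v B hB
    obtain ⟨b, hb, hb'⟩ := G.isPrefixed_muLim v B hB
    refine ⟨b, hb, ?_⟩
    dsimp only
    rcases eq_or_ne (G.muLim v B) ⊤ with htop | hfin
    · rw [htop, ENat.map_top]
      exact le_top
    obtain ⟨m, hm⟩ := ENat.ne_top_iff_exists.1 hfin
    rw [← hm] at hb' ⊢
    refine G.eNext_le_eNext hB (fun u R hu hR h => ?_) hb'
    obtain ⟨n, hn, hnm⟩ := (required_le_coe_iff _ _ _).1 h
    rw [hn, map_natCast_eq, map_natCast_eq, required_le_coe_iff]
    refine ⟨_, rfl, ?_⟩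
    have hw := G.natAbs_weight_le hu
    have hn' := hgap u R n hR hn
    have hm' := hgap v B m hB hm.symm
    simp only [f]
    split_ifs <;> omega
  have := G.muLim_le_of_isPrefixed hpre (v := v) hB
  rw [hm, map_natCast_eq, Nat.cast_le] at this
  simp only [f, if_pos ht] at this
  omega

theorem muLim_le_of_ne_top [Fintype V] {v : V} {B : ℕ} (hB : B ≤ G.kstar)
    (hfin : G.muLim v B ≠ ⊤) :
    G.muLim v B ≤ ((Fintype.card V * (2 * G.k + 2) * G.maxWeight : ℕ) : ℕ∞) := by
  obtain ⟨m, hm⟩ := ENat.ne_top_iff_exists.1 hfin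
  rw [← hm, Nat.cast_le]
  by_contra! hlt
  set N := Fintype.card V * (2 * G.k + 2) with hN
  have hmul (j : ℕ) (hj : j < N) : j * G.maxWeight + G.maxWeight ≤ N * G.maxWeight := by
    rw [← Nat.succ_mul]; exact Nat.mul_le_mul_right _ hj
  have hex (j : Fin N) := G.exists_muLim_mem_Ioc hB hm.symm
    (t := j * G.maxWeight) ((hmul j j.2).trans_lt hlt)
  choose u R n hR hn hlo hhi using hex
  -- Each of the `N` disjoint intervals `(jW, (j+1)W]` contains a value, and `m` lies above them
  -- all: `N + 1` distinct configurations out of `N`.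
  let g : Option (Fin N) → V × Fin (2 * G.k + 2) := fun o => o.elim
    (v, ⟨B, by rw [kstar_eq] at hB; omega⟩)
    fun j => (u j, ⟨R j, by have := hR j; rw [kstar_eq] at this; omega⟩)
  have hval (i j : Fin N) (hij : i < j) : n i < n j := by
    have h1 := hhi i
    have h2 := hlo j
    have h3 : ((i : ℕ) + 1) * G.maxWeight ≤ j * G.maxWeight := Nat.mul_le_mul_right _ hij
    rw [Nat.succ_mul] at h3
    omega
  have hg : Function.Injective g := by
    have hne (j : Fin N) : g none ≠ g (some j) := by
      intro h
      simp only [g, Option.elim, Prod.mk.injEq, Fin.mk.injEq] at h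
      have h1 := hn j
      rw [← h.1, ← h.2, ← hm, Nat.cast_inj] at h1
      have h2 := hmul j j.2
      have h3 := hhi j
      omega
    rintro (_ | i) (_ | j) h
    · rfl
    · exact (hne j h).elim
    · exact (hne i h.symm).elim
    · simp only [g, Option.elim, Prod.mk.injEq, Fin.mk.injEq] at h
      have h1 := hn i
      rw [h.1, h.2, hn j, Nat.cast_inj] at h1
      rcases lt_trichotomy i j with hij | hij | hij
      · have := hval _ _ hij; omega
      · rw [hij]
      · have := hval _ _ hij; omega
  have := Fintype.card_le_of_injective g hg
  simp only [Fintype.card_option, Fintype.card_fin, Fintype.card_prod] at this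
  omega

theorem mu_eq_muLim [Fintype V] {v : V} {B : ℕ} (hB : B ≤ G.kstar) : G.mu v B = G.muLim v B := by
  by_cases h : G.muLim v B = ⊤
  · by_cases hle : ∀ n, G.muIter n v B ≤
        ((Fintype.card V * (2 * G.k + 2) * G.maxWeight : ℕ) : ℕ∞)
    · have : G.muLim v B ≤ _ := iSup_le hle
      rw [h] at this
      exact absurd (top_le_iff.1 this) (ENat.natCast_ne_top _)
    · push Not at hle
      obtain ⟨n, hn⟩ := hle
      rw [h, ← top_le_iff]
      refine le_trans (le_of_eq ?_) (le_iSup _ n)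
      simp only [muTrim, if_neg hn.not_ge]
  · have hle := G.muLim_le_of_ne_top hB h
    refine iSup_congr fun n => ?_
    have : G.muIter n v B ≤ G.muLim v B := le_iSup (fun n => G.muIter n v B) n
    simp only [muTrim, if_pos (this.trans hle)]

theorem mu_anti [Fintype V] (v : V) {B B' : ℕ} (h : B ≤ B') (hB' : B' ≤ G.kstar) :
    G.mu v B' ≤ G.mu v B := by
  rw [G.mu_eq_muLim hB', G.mu_eq_muLim (h.trans hB')]
  exact G.muLim_antitone v h

theorem isPrefixed_mu [Fintype V] : G.IsPrefixed G.mu := by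
  intro v B hB
  obtain ⟨b, hb, hb'⟩ := G.isPrefixed_muLim v B hB
  rw [G.mu_eq_muLim hB]
  exact ⟨b, hb, (G.eNext_mono (fun u R hR => (G.mu_eq_muLim hR).le) hB b).trans hb'⟩

theorem exists_isVIStrategy [Fintype V] : ∃ s : Config V → Action V, G.IsVIStrategy s := by
  have hb (c : Config V) : ∃ b, IsBid c.2 b ∧
      ∀ b', IsBid c.2 b' → G.eNext G.mu c.1 c.2 b ≤ G.eNext G.mu c.1 c.2 b' := by
    obtain ⟨b, hb, h⟩ := (biInf_le_iff ⟨0, isBid_zero c.2⟩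
      (fun b => G.eNext G.mu c.1 c.2 b) _).1 le_rfl
    exact ⟨b, hb, fun b' hb' => h.trans (iInf₂_le b' hb')⟩
  choose b hb using hb
  have hu (c : Config V) : ∃ u, G.Adj c.1 u ∧ ∀ u', G.Adj c.1 u' →
      required (G.mu u (c.2 - b c)) (G.weight c.1 u) ≤
        required (G.mu u' (c.2 - b c)) (G.weight c.1 u') := by
    obtain ⟨u, hu, h⟩ := (biInf_le_iff (G.exists_adj c.1)
      (fun u => required (G.mu u (c.2 - b c)) (G.weight c.1 u)) _).1 le_rfl
    exact ⟨u, hu, fun u' hu' => h.trans (iInf₂_le u' hu')⟩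
  choose u hu using hu
  exact ⟨fun c => (b c, u c), fun v B _ => ⟨hb (v, B), hu (v, B)⟩⟩

/-! ## Plays -/

/-- `a` is allowed for Consumer in the configuration `c`. -/
def ConsAllowed (c : Config V) (a : Action V) : Prop :=
  IsBid (G.kstar - c.2) a.1 ∧ G.Adj c.1 a.2

theorem presWinsPath_of_invariant {σ τ : Strategy V} (hτ : G.ConsLegal τ)
    (I : ℤ → Config V → Prop) (hI : ∀ l c, I l c → 0 ≤ l ∧ c.2 ≤ G.kstar)
    (hstep : ∀ l c h a, I l c → G.ConsAllowed c a →
      I (l + G.weight c.1 (step c (σ h c) a).1) (step c (σ h c) a))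
    {M : ℕ} {c : Config V} (h₀ : I M c) : G.PresWinsPath M (path c σ τ) := by
  have key (m : ℕ) : I (M + G.sumWeights (path c σ τ) m) (run c σ τ m).2 := by
    induction m with
    | zero => simpa [sumWeights, run] using h₀
    | succ m ih =>
      have h := hstep _ _ (run c σ τ m).1 (τ (run c σ τ m).1 (run c σ τ m).2) ih
        (hτ _ _ _ (hI _ _ ih).2)
      simp only [sumWeights, Finset.sum_range_succ, ← add_assoc] at h ⊢
      exact h
  exact fun m => (hI _ _ (key m)).1

/-- `run` recurses on the last turn; splitting off the first turn is what passing to a residual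
strategy needs. -/
theorem run_succ_eq_cons (c : Config V) (σ τ : Strategy V) (n : ℕ) :
    run c σ τ (n + 1) =
      let p := run (step c (σ [] c) (τ [] c)) (fun h => σ (c :: h)) (fun h => τ (c :: h)) n
      (c :: p.1, p.2) := by
  induction n with
  | zero => rfl
  | succ n ih =>
    rw [run, ih]
    rfl

theorem StrategyWins.tail {G : Game V} {σ : Strategy V} {M : ℕ} {c : Config V}
    (h : G.StrategyWins σ M c) {a : Action V} (ha : G.ConsAllowed c a) :
    ∃ M' : ℕ, (M' : ℤ) = M + G.weight c.1 (step c (σ [] c) a).1 ∧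
      G.StrategyWins (fun h => σ (c :: h)) M' (step c (σ [] c) a) := by
  -- Consumer plays `a` first and then `τ'`. The case `x ≠ c` does not arise in the play from `c`;
  -- it only keeps the strategy legal.
  let τ (τ' : Strategy V) : Strategy V := fun h x =>
    if h = [] then (if x = c then a else τ' [] x) else τ' h.tail x
  have hτ (τ' : Strategy V) (hτ' : G.ConsLegal τ') : G.ConsLegal (τ τ') := by
    intro h v B hB
    simp only [τ]
    split_ifs with h₁ h₂
    · subst h₂; exact ha
    · exact hτ' _ _ _ hB
    · exact hτ' _ _ _ hB
  have hpath (τ' : Strategy V) (n : ℕ) : path c σ (τ τ') (n + 1) =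
      path (step c (σ [] c) a) (fun h => σ (c :: h)) τ' n := by
    unfold path
    rw [run_succ_eq_cons]
    simp [τ]
  have hsum (τ' : Strategy V) (n : ℕ) : G.sumWeights (path c σ (τ τ')) (n + 1) =
      G.weight c.1 (step c (σ [] c) a).1 +
        G.sumWeights (path (step c (σ [] c) a) (fun h => σ (c :: h)) τ') n := by
    unfold sumWeights
    rw [Finset.sum_range_succ', add_comm]
    simp only [hpath]
    rfl
  -- Some legal continuation must exist for the energy after the first turn to be known nonnegative.
  obtain ⟨τ₀, hτ₀⟩ : ∃ τ₀ : Strategy V, G.ConsLegal τ₀ := by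
    choose u hu using G.exists_adj
    exact ⟨fun _ c => (0, u c.1), fun _ v B _ => ⟨isBid_zero _, hu v⟩⟩
  have hnn := h.2 _ (hτ τ₀ hτ₀) 1
  rw [hsum] at hnn
  simp only [sumWeights, Finset.range_zero, Finset.sum_empty, add_zero] at hnn
  refine ⟨(M + G.weight c.1 (step c (σ [] c) a).1).toNat, Int.toNat_of_nonneg hnn,
    fun _ => h.1 _, fun τ' hτ' m => ?_⟩
  have := h.2 _ (hτ τ' hτ') (m + 1)
  rw [hsum] at this
  rw [Int.toNat_of_nonneg hnn]
  linarith

/-! ### Energy thresholds equal the limit of value iteration -/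

theorem energy_le_coe_iff (v : V) (B M : ℕ) :
    G.energy v B ≤ M ↔ ∃ m ≤ M, ∃ σ : Strategy V, G.StrategyWins σ m (v, B) := by
  constructor
  · intro h
    have hne : ∃ m : ℕ, ∃ σ : Strategy V, G.StrategyWins σ m (v, B) := by
      by_contra! hc
      have : G.energy v B = ⊤ := by simp [energy, hc]
      exact ENat.natCast_ne_top M (top_le_iff.1 (this ▸ h))
    obtain ⟨m, hm, hle⟩ := (biInf_le_iff hne _ _).1 h
    exact ⟨m, by exact_mod_cast hle, hm⟩
  · rintro ⟨m, hm, hσ⟩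
    exact (iInf₂_le m hσ).trans (by exact_mod_cast hm)

theorem required_energy_le {σ : Strategy V} {M : ℕ} {c : Config V} (h : G.StrategyWins σ M c)
    {a : Action V} (ha : G.ConsAllowed c a) {u : V} {R : ℕ} (hstep : step c (σ [] c) a = (u, R)) :
    required (G.energy u R) (G.weight c.1 u) ≤ M := by
  obtain ⟨M', hM', hw⟩ := h.tail ha
  rw [hstep] at hM' hw
  have hle : G.energy u R ≤ M' := (G.energy_le_coe_iff u R M').2 ⟨M', le_rfl, _, hw⟩
  refine (required_mono hle _).trans ((required_le_coe_iff _ _ _).2 ⟨M', rfl, ?_⟩)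
  simp only at hM'
  omega

/-- The first bid of a winning strategy is a witness: Consumer may answer by trumping it, if
affordable, or by bidding 0, and the rest of the strategy must win from the resulting configuration.
-/
theorem isPrefixed_energy : G.IsPrefixed G.energy := by
  intro v B hB
  rcases eq_or_ne (G.energy v B) ⊤ with htop | hfin
  · exact ⟨0, isBid_zero B, htop ▸ le_top⟩
  obtain ⟨M, hM⟩ := ENat.ne_top_iff_exists.1 hfin
  obtain ⟨m, hm, σ, hσ⟩ := (G.energy_le_coe_iff v B M).1 hM.ge
  obtain ⟨hbid, hadj⟩ := hσ.1 [] v B hB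
  refine ⟨(σ [] (v, B)).1, hbid, ?_⟩
  rw [← hM]
  refine le_trans ?_ (Nat.cast_le.2 hm)
  set b := (σ [] (v, B)).1 with hb
  have hlose (hk : B + trump B b ≤ G.kstar) (u : V) (hu : G.Adj v u) :
      required (G.energy u (B + trump B b)) (G.weight v u) ≤ m := by
    refine G.required_energy_le hσ (a := (trump B b, u)) ⟨?_, hu⟩ ?_
    · simp only [IsBid, trump, Nat.odd_iff, kstar_eq] at *
      split_ifs at * <;> omega
    · rw [step, if_neg]
      rw [← hb]
      simp only [IsBid, PresWinsBidding, trump, Nat.odd_iff] at *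
      split_ifs at * <;> omega
  refine (G.eNext_le_iff _ _ _ _ _).2 ⟨?_, hlose⟩
  by_cases h0 : PresWinsBidding B b 0
  · obtain ⟨u, hu⟩ := G.exists_adj v
    exact ⟨_, hadj, G.required_energy_le hσ (a := (0, u)) ⟨isBid_zero _, hu⟩ (if_pos h0)⟩
  -- Preserver bids 0 and holds the advantage, so Consumer wins the tie at 0. Either outcome leaves
  -- the budget at `B`, so the bound for losing also covers winning.
  · obtain ⟨u, hu⟩ := G.exists_adj v
    have hb0 : b = 0 ∧ Odd B := by
      simp only [PresWinsBidding, Nat.odd_iff] at h0 ⊢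
      omega
    have ht : trump B b = 0 := by
      simp [trump, hb0.1, hb0.2]
    have := hlose (by omega) u hu
    rw [ht] at this
    exact ⟨u, hu, by simpa [hb0.1] using this⟩

theorem mu_le_energy [Fintype V] {v : V} {B : ℕ} (hB : B ≤ G.kstar) :
    G.mu v B ≤ G.energy v B :=
  (G.mu_eq_muLim hB).le.trans (G.muLim_le_of_isPrefixed G.isPrefixed_energy hB)

/-- One turn of a value-iteration strategy that is played at budget `B` as if the budget were `R`:
the excess `B - R` is preserved, and `mu` at the simulated budget bounds the required energy. -/
theorem IsVIStrategy.step_eq [Fintype V] {G : Game V} {s : Config V → Action V}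
    (hs : G.IsVIStrategy s) {v : V} {R B m : ℕ} (hpar : Odd R ↔ Odd B) (hRB : R ≤ B)
    (hB : B ≤ G.kstar) (hm : G.mu v R = m) {a : Action V} (ha : G.ConsAllowed (v, B) a) :
    ∃ u R' m', step (v, B) (s (v, R)) a = (u, R' + (B - R)) ∧ R' + (B - R) ≤ G.kstar ∧
      G.mu u R' = (m' : ℕ) ∧ (m' : ℤ) ≤ m + G.weight v u := by
  obtain ⟨⟨hbid, hmin⟩, hadj, humin⟩ := hs v R (hRB.trans hB)
  obtain ⟨b₀, hb₀, hle⟩ := G.isPrefixed_mu v R (hRB.trans hB)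
  have hnext := (hmin b₀ hb₀).trans (hle.trans hm.le)
  obtain ⟨⟨u₀, hu₀, hwin⟩, hlose⟩ := (G.eNext_le_iff _ _ _ _ _).1 hnext
  obtain ⟨ha, haadj⟩ := ha
  set b := (s (v, R)).1 with hb
  set u := (s (v, R)).2 with hu
  unfold step
  split_ifs with hW
  · obtain ⟨m', hm', hle⟩ := (required_le_coe_iff _ _ _).1 ((humin u₀ hu₀).trans hwin)
    have := hbid.1
    refine ⟨u, R - b, m', ?_, by omega, hm', hle⟩
    simp only [Prod.mk.injEq, ← hb, ← hu, true_and]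
    omega
  -- `R` and `B` agree on the advantage, so `b` has the same trump at both. A Consumer bid above the
  -- trump only raises Preserver's budget, and `mu` is antitone.
  · have hab : trump R b ≤ a.1 := by
      simp only [IsBid, PresWinsBidding, trump, Nat.odd_iff, kstar_eq, ← hb] at *
      split_ifs <;> omega
    have hak : B + a.1 ≤ G.kstar := by
      have := ha.1
      simp only at this
      omega
    obtain ⟨m₁, hm₁, hle₁⟩ := (required_le_coe_iff _ _ _).1 (hlose (by omega) a.2 haadj)
    have hmu : G.mu a.2 (R + a.1) ≤ m₁ := hm₁ ▸ G.mu_anti a.2 (by omega) (by omega)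
    obtain ⟨m', hm'⟩ := ENat.ne_top_iff_exists.1 (ne_top_of_le_ne_top (ENat.natCast_ne_top _) hmu)
    rw [← hm', Nat.cast_le] at hmu
    refine ⟨a.2, R + a.1, m', ?_, by omega, hm'.symm, by omega⟩
    simp only [Prod.mk.injEq, true_and]
    omega

theorem energy_le_mu [Fintype V] {v : V} {B : ℕ} (hB : B ≤ G.kstar) :
    G.energy v B ≤ G.mu v B := by
  rcases eq_or_ne (G.mu v B) ⊤ with htop | hfin
  · exact htop ▸ le_top
  obtain ⟨M, hM⟩ := ENat.ne_top_iff_exists.1 hfin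
  obtain ⟨s, hs⟩ := G.exists_isVIStrategy
  rw [← hM, energy_le_coe_iff]
  refine ⟨M, le_rfl, fun _ c => s c, fun _ v B hB => ⟨(hs v B hB).1.1, (hs v B hB).2.1⟩,
    fun τ hτ => ?_⟩
  refine G.presWinsPath_of_invariant hτ
    (fun l c => c.2 ≤ G.kstar ∧ ∃ m : ℕ, G.mu c.1 c.2 = m ∧ (m : ℤ) ≤ l)
    (fun l c h => ⟨?_, h.1⟩) ?_ ⟨hB, M, hM.symm, le_rfl⟩
  · obtain ⟨-, m, -, hm⟩ := h
    omega
  · rintro l ⟨v, B⟩ h a ⟨hB, m, hm, hml⟩ ha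
    obtain ⟨u, R', m', hstep, hk, hm', hle⟩ := hs.step_eq Iff.rfl le_rfl hB hm ha
    simp only [hstep]
    rw [Nat.sub_self, add_zero] at hk ⊢
    exact ⟨hk, m', hm', by simp only at hle; omega⟩

theorem energy_eq_mu [Fintype V] {v : V} {B : ℕ} (hB : B ≤ G.kstar) :
    G.energy v B = G.mu v B :=
  le_antisymm (G.energy_le_mu hB) (G.mu_le_energy hB)

/-! ## Thresholds and trimming -/

theorem energy_Th_lt_top {v : V} (h : G.Th v ≤ G.kstar) : G.energy v (G.Th v) < ⊤ := by
  unfold Th at h ⊢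
  split_ifs at h ⊢ with hall
  · omega
  · push Not at hall
    obtain ⟨B, hB, hB'⟩ := hall
    exact (Nat.sInf_mem (s := {B | B ≤ G.kstar ∧ G.energy v B < ⊤}) ⟨B, hB, hB'.lt_top⟩).2

theorem Th_le {v : V} {B : ℕ} (hB : B ≤ G.kstar) (h : G.energy v B < ⊤) : G.Th v ≤ B := by
  unfold Th
  rw [if_neg fun hall => h.ne (hall B hB)]
  exact Nat.sInf_le ⟨hB, h⟩

theorem Th_le_relBud (v : V) (B : ℕ) : G.Th v ≤ G.relBud v B := by
  unfold relBud
  split_ifs <;> omega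

theorem odd_relBud (v : V) (B : ℕ) : Odd (G.relBud v B) ↔ Odd B := by
  unfold relBud
  split_ifs with h
  · exact h.symm
  · rw [Nat.odd_add_one]
    tauto

theorem relBud_congr (v : V) {B B' : ℕ} (h : Odd B ↔ Odd B') : G.relBud v B = G.relBud v B' := by
  simp only [relBud, h]

theorem relBud_le {v : V} {B : ℕ} (h : G.Th v ≤ B) : G.relBud v B ≤ B := by
  simp only [relBud, Nat.odd_iff]
  split_ifs <;> omega

theorem budgetAgnostic_agnostic (s : Config V → Action V) : G.BudgetAgnostic (G.agnostic s) := by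
  intro v B _ h _ _
  simp only [agnostic, if_pos h, if_pos (G.Th_le_relBud v B),
    G.relBud_congr v (G.odd_relBud v B)]

theorem IsVIStrategy.presLegal_agnostic [Fintype V] {G : Game V} {s : Config V → Action V}
    (hs : G.IsVIStrategy s) : G.PresLegal (G.agnostic s) := by
  intro h v B hB
  simp only [agnostic]
  split_ifs with hT
  · have hle := G.relBud_le hT
    obtain ⟨⟨⟨hb, hodd⟩, -⟩, hadj, -⟩ := hs v _ (hle.trans hB)
    exact ⟨⟨hb.trans hle, fun ho => (G.odd_relBud v B).1 (hodd ho)⟩, hadj⟩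
  · exact ⟨(hs v B hB).1.1, (hs v B hB).2.1⟩

theorem iSup_energy_Th_ne_top [Fintype V] :
    (⨆ (v : V) (_ : G.Th v ≤ G.kstar), G.energy v (G.Th v)) ≠ ⊤ := by
  refine ne_top_of_le_ne_top
    (ENat.natCast_ne_top (Finset.univ.sup fun v => (G.energy v (G.Th v)).toNat)) ?_
  refine iSup₂_le fun v hv => ?_
  rw [← ENat.natCast_toNat (G.energy_Th_lt_top hv).ne, Nat.cast_le]
  exact Finset.le_sup (f := fun v => (G.energy v (G.Th v)).toNat) (Finset.mem_univ v)

/-- The invariant is that the energy covers `mu` at the trimmed budget plus a reserve of `E` for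
each of the at most `k` minus half the excess trimmings still to come. -/
theorem IsVIStrategy.strategyWins_agnostic [Fintype V] {G : Game V} {s : Config V → Action V}
    (hs : G.IsVIStrategy s) {E M : ℕ}
    (hE : ∀ v, G.Th v ≤ G.kstar → G.energy v (G.Th v) ≤ E) (hM : (G.k + 1) * E ≤ M)
    {v : V} {B : ℕ} (hB : B ≤ G.kstar) (hT : G.Th v ≤ B) :
    G.StrategyWins (G.agnostic s) M (v, B) := by
  refine ⟨hs.presLegal_agnostic, fun τ hτ => ?_⟩
  have hrel {v : V} {B : ℕ} (hB : B ≤ G.kstar) (hT : G.Th v ≤ B) :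
      ∃ m : ℕ, G.mu v (G.relBud v B) = m ∧ m ≤ E := by
    have h₁ := G.mu_anti v (G.Th_le_relBud v B) ((G.relBud_le hT).trans hB)
    rw [← G.energy_eq_mu (hT.trans hB)] at h₁
    have h₂ := h₁.trans (hE v (hT.trans hB))
    obtain ⟨m, hm⟩ := ENat.ne_top_iff_exists.1 (ne_top_of_le_ne_top (ENat.natCast_ne_top E) h₂)
    rw [← hm, Nat.cast_le] at h₂
    exact ⟨m, hm.symm, h₂⟩
  refine G.presWinsPath_of_invariant hτ
    (fun l c => c.2 ≤ G.kstar ∧ G.Th c.1 ≤ c.2 ∧ ∃ m : ℕ, G.mu c.1 (G.relBud c.1 c.2) = m ∧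
      ((m + (G.k - (c.2 - G.relBud c.1 c.2) / 2) * E : ℕ) : ℤ) ≤ l)
    (fun l c h => ⟨?_, h.1⟩) ?_ ⟨hB, hT, ?_⟩
  · obtain ⟨-, -, m, -, hm⟩ := h
    omega
  · rintro l ⟨v, B⟩ h a ⟨hB, hT, m, hm, hml⟩ ha
    simp only at hB hT hm hml
    set R := G.relBud v B with hR
    have hRB : R ≤ B := G.relBud_le hT
    have hpar : Odd R ↔ Odd B := G.odd_relBud v B
    obtain ⟨u, R', m', hstep, hk, hm', hle⟩ := hs.step_eq hpar hRB hB hm ha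
    have hagn : G.agnostic s h (v, B) = s (v, R) := if_pos hT
    rw [hagn]
    simp only [hstep]
    -- `mu` is finite at the simulated budget, so play never drops below the threshold.
    have hTu : G.Th u ≤ R' := by
      refine G.Th_le (by omega) ?_
      rw [G.energy_eq_mu (by omega), hm']
      exact ENat.natCast_lt_top _
    refine ⟨hk, by omega, ?_⟩
    have hpar' : Odd (R' + (B - R)) ↔ Odd R' := by
      simp only [Nat.odd_iff] at *
      omega
    have hS : G.relBud u R' ≤ R' := G.relBud_le hTu
    have hSpar := G.odd_relBud u R'
    rw [G.relBud_congr u hpar']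
    set S := G.relBud u R'
    rcases hS.eq_or_lt with heq | hlt
    · refine ⟨m', heq ▸ hm', ?_⟩
      rw [heq, Nat.add_sub_cancel_left]
      push_cast at hml ⊢
      linarith
    · obtain ⟨n, hn, hnE⟩ := hrel (v := u) (B := R') (by omega) hTu
      refine ⟨n, hn, ?_⟩
      -- `S < R'` agree in parity, so half the excess grows by at least one. It stays at most `k`
      -- because the actual budget is at most `2k + 1`, so the subtraction is not truncated and one
      -- `E` is released to pay for `n`.
      have hs : G.k - (R' + (B - R) - S) / 2 + 1 ≤ G.k - (B - R) / 2 := by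
        simp only [Nat.odd_iff, kstar_eq] at *
        omega
      have := Nat.mul_le_mul_right E hs
      rw [Nat.succ_mul] at this
      omega
  · obtain ⟨m, hm, hmE⟩ := hrel hB hT
    refine ⟨m, hm, ?_⟩
    have : (G.k - (B - G.relBud v B) / 2) * E ≤ G.k * E := Nat.mul_le_mul_right _ (Nat.sub_le _ _)
    rw [Nat.succ_mul] at hM
    simp only
    omega

end Game

end EnergyBidding

theorem mainTheorem4 {V : Type*} [Fintype V] (G : EnergyBidding.Game V) :
    (∃ s : EnergyBidding.Config V → EnergyBidding.Action V, G.IsVIStrategy s) ∧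
    ∀ s : EnergyBidding.Config V → EnergyBidding.Action V, G.IsVIStrategy s →
      G.BudgetAgnostic (G.agnostic s) ∧
      ∀ (v : V) (B : ℕ), B ≤ G.kstar → G.Th v ≤ B →
        ∃ M : ℕ, (M : ℕ∞) = G.initialEnergy ∧ G.StrategyWins (G.agnostic s) M (v, B) := by
  refine ⟨G.exists_isVIStrategy, fun s hs => ⟨G.budgetAgnostic_agnostic s, fun v B hB hT => ?_⟩⟩
  obtain ⟨E, hE⟩ := ENat.ne_top_iff_exists.1 G.iSup_energy_Th_ne_top
  -- The invariant needs only `(k + 1) * E`; the summand `W` is slack.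
  refine ⟨(G.k + 1) * (G.maxWeight + E), ?_, hs.strategyWins_agnostic (E := E) (fun u hu => ?_)
    (Nat.mul_le_mul_left _ (Nat.le_add_left _ _)) hB hT⟩
  · rw [EnergyBidding.Game.initialEnergy, ← hE]
    push_cast
    rfl
  · rw [hE]
    exact le_iSup₂ (f := fun (v : V) (_ : G.Th v ≤ G.kstar) => G.energy v (G.Th v)) u hu
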